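/- For graphs $G$ and $H$, let $r(G,H)$ be the smallest positive integer $N$ such that every red-blue colouring of the edges of the complete graph $K_N$ contains a red copy of $G$ or a blue copy of $H$ (as a not necessarily induced subgraph). Let $K_{1,n-1}$ be the star with $n$ vertices, let $F_k$ be the fan consisting of $k$ triangles that share exactly one common vertex and are otherwise disjoint, and let $tF_k$ be the disjoint union of $t$ copies of $F_k$. For a graph $H$ with chromatic number $\chi(H)$, let $s(H)$ be the smallest size of a colour class over all proper colourings of $H$ with $\chi(H)$ colours. A connected graph $G$ with $n\ge s(H)$ vertices is called $H$-good if $r(G,H)=(\chi(H)-1)(n-1)+s(H)$. **Theorem.** Let $k,t\ge 1$ and $n$ be integers with $n\ge\max\{12tk+2k,\,4tk^2\}$. Then $$r(K_{1,n-1},tF_k)=2n+t-2,$$ and $K_{1,n-1}$ is $tF_k$-good. -/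

import Mathlib

open SimpleGraph

/-- The Ramsey number `r(G, H)`: the least positive integer `N` such that every red-blue colouring
of the edges of the complete graph on `N` vertices contains a red copy of `G` or a blue copy
of `H`. A colouring is given by its red graph `R`; the blue graph is the complement `Rᶜ`. -/
noncomputable def ramseyNumber {V W : Type*} (G : SimpleGraph V) (H : SimpleGraph W) : ℕ :=
  sInf {N : ℕ | 0 < N ∧ ∀ R : SimpleGraph (Fin N), G.IsContained R ∨ H.IsContained Rᶜ}

/-- The star `K_{1,m}` with `m` edges. -/
def graphStar (m : ℕ) : SimpleGraph (Fin 1 ⊕ Fin m) :=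
  completeBipartiteGraph (Fin 1) (Fin m)

/-- The join `G + H`: the disjoint union of `G` and `H` together with all edges between them. -/
def graphJoin {V W : Type*} (G : SimpleGraph V) (H : SimpleGraph W) : SimpleGraph (V ⊕ W) :=
  (G ⊕g H) ⊔ completeBipartiteGraph V W

/-- The disjoint union `tH` of `t` copies of `H`; the first coordinate is the number of the copy. -/
def graphCopies {W : Type*} (t : ℕ) (H : SimpleGraph W) : SimpleGraph (Fin t × W) where
  Adj p q := p.1 = q.1 ∧ H.Adj p.2 q.2
  symm.symm _ _ h := ⟨h.1.symm, h.2.symm⟩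
  loopless.irrefl _ h := H.irrefl h.2

/-- The fan `F_k = K_1 + kK_2`: `k` triangles with exactly one vertex in common. -/
def graphFan (k : ℕ) : SimpleGraph (Fin 1 ⊕ (Fin k × Fin 2)) :=
  graphJoin (completeGraph (Fin 1)) (graphCopies k (completeGraph (Fin 2)))

/-- The chromatic surplus `s(H)`: the least size of a colour class in a proper colouring of `H`
with `χ(H)` colours. -/
noncomputable def chromaticSurplus {W : Type*} (H : SimpleGraph W) : ℕ :=
  sInf {m : ℕ | ∃ (C : H.Coloring (Fin H.chromaticNumber.toNat))
    (i : Fin H.chromaticNumber.toNat), m = (C.colorClass i).ncard}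

/-- `G` is `H`-good (in the sense of Burr): `G` is connected, has `n ≥ s(H)` vertices, and
`r(G, H) = (χ(H) - 1)(n - 1) + s(H)`. -/
def IsRamseyGood {V W : Type*} (G : SimpleGraph V) (H : SimpleGraph W) : Prop :=
  G.Connected ∧ chromaticSurplus H ≤ Nat.card V ∧
    ramseyNumber G H =
      (H.chromaticNumber.toNat - 1) * (Nat.card V - 1) + chromaticSurplus H

/-! Lower bound: colour red two cliques of order n-1 and one clique of order t-1. No red star fits,
and a blue tF_k would be 3-coloured with a class of at most t-1 vertices, although each of its t
copies contains a triangle and so meets every class.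

Upper bound: without a red star the blue graph G on 2n+t-2 vertices has minimum degree at least
n+t-1. It suffices to find t disjoint sets that are robust seeds of fans (`Completable`), since
seeds can be exchanged for fans one at a time. Let X be the vertices that are seeds by themselves.
If |X| < t, delete X. Every remaining neighbourhood is almost independent, which forces an almost
bipartition A, B (`exists_almost_bipartition`). Put r = t-|X|. The minimum degree gives every vertex
of A at least D-|B| neighbours in A, and every vertex of B at least D-|A| in B, where D = n+r-1;
these two numbers add up to r. A side with inner degrees at least m contains m disjoint k-edge stars
or matchings (`exists_stars_matchings`). Both are seeds: a star takes its remaining vertices from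
the other side, a matching its centre. -/

/-! ### Packings of disjoint sets and their replacement. -/

section Packing

variable {V : Type*}

/-- `A` contains `m` pairwise disjoint sets with property `Q`. -/
def HasPacking (Q : Finset V → Prop) (A : Finset V) (m : ℕ) : Prop :=
  ∃ U : Fin m → Finset V, (∀ i, Q (U i) ∧ U i ⊆ A) ∧ Pairwise fun i j => Disjoint (U i) (U j)

theorem HasPacking.zero (Q : Finset V → Prop) (A : Finset V) : HasPacking Q A 0 :=
  ⟨fun _ => ∅, fun i => i.elim0, fun i => i.elim0⟩

theorem HasPacking.one {Q : Finset V → Prop} {A U : Finset V} (hU : Q U) (hA : U ⊆ A) :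
    HasPacking Q A 1 :=
  ⟨fun _ => U, fun _ => ⟨hU, hA⟩, fun i j hij => (hij (Subsingleton.elim i j)).elim⟩

theorem HasPacking.mono {Q Q' : Finset V → Prop} {A B : Finset V} {m : ℕ}
    (h : HasPacking Q A m) (hAB : A ⊆ B) (hQ : ∀ U ⊆ A, Q U → Q' U) : HasPacking Q' B m := by
  obtain ⟨U, hU, hd⟩ := h
  exact ⟨U, fun i => ⟨hQ _ (hU i).2 (hU i).1, (hU i).2.trans hAB⟩, hd⟩

theorem HasPacking.of_le {Q : Finset V → Prop} {A : Finset V} {m m' : ℕ}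
    (h : HasPacking Q A m) (hm : m' ≤ m) : HasPacking Q A m' := by
  obtain ⟨U, hU, hd⟩ := h
  exact ⟨fun i => U (Fin.castLE hm i), fun i => hU _,
    fun i j hij => hd fun h => hij (Fin.castLE_injective hm h)⟩

/-- The singletons inside `A` form a packing. -/
theorem HasPacking.singletons {Q : Finset V → Prop} {A : Finset V} (h : ∀ v ∈ A, Q {v}) :
    HasPacking Q A A.card := by
  refine ⟨fun i => {(A.equivFin.symm i : V)}, fun i => ⟨h _ (A.equivFin.symm i).2, ?_⟩,
    fun i j hij => ?_⟩
  · simp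
  · simp only [Finset.disjoint_singleton]
    exact fun h => hij (A.equivFin.symm.injective (Subtype.ext h))

variable [DecidableEq V]

theorem HasPacking.add {Q : Finset V → Prop} {A B : Finset V} {m m' : ℕ}
    (hA : HasPacking Q A m) (hB : HasPacking Q B m') (hAB : Disjoint A B) :
    HasPacking Q (A ∪ B) (m + m') := by
  obtain ⟨U, hU, hd⟩ := hA
  obtain ⟨U', hU', hd'⟩ := hB
  refine ⟨Fin.append U U', fun i => ?_, fun i j => ?_⟩
  · refine Fin.addCases (fun i => ?_) (fun i => ?_) i
    · rw [Fin.append_left]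
      exact ⟨(hU i).1, (hU i).2.trans Finset.subset_union_left⟩
    · rw [Fin.append_right]
      exact ⟨(hU' i).1, (hU' i).2.trans Finset.subset_union_right⟩
  · refine Fin.addCases (fun i => ?_) (fun i => ?_) i <;>
      refine Fin.addCases (fun j => ?_) (fun j => ?_) j <;> intro hij <;>
      simp only [Fin.append_left, Fin.append_right]
    · exact hd fun h => hij (by rw [h])
    · exact hAB.mono (hU i).2 (hU' j).2
    · exact hAB.symm.mono (hU' i).2 (hU j).2
    · exact hd' fun h => hij (by rw [h])

/-- Either there are `m` disjoint `Q`-sets in `A`, or a smaller packing is maximal. -/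
theorem HasPacking.or_maximal (Q : Finset V → Prop) {c : ℕ} (hc : ∀ U, Q U → U.card ≤ c)
    (A : Finset V) (m : ℕ) :
    HasPacking Q A m ∨ ∃ s < m, ∃ S ⊆ A, HasPacking Q S s ∧ S.card ≤ s * c ∧
      ∀ U ⊆ A \ S, ¬ Q U := by
  induction m with
  | zero => exact Or.inl (.zero Q A)
  | succ m ih =>
    rcases ih with h | ⟨s, hs, h⟩
    · obtain ⟨U, hU, hd⟩ := h
      set S := Finset.univ.biUnion U with hS
      have hSA : S ⊆ A := Finset.biUnion_subset.2 fun i _ => (hU i).2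
      have hp : HasPacking Q S m :=
        ⟨U, fun i => ⟨(hU i).1, Finset.subset_biUnion_of_mem U (Finset.mem_univ i)⟩, hd⟩
      by_cases hmax : ∃ U' ⊆ A \ S, Q U'
      · obtain ⟨U', hU', hQ⟩ := hmax
        left
        have := hp.add (HasPacking.one hQ hU') Finset.disjoint_sdiff
        rwa [Finset.union_sdiff_of_subset hSA] at this
      · push Not at hmax
        refine Or.inr ⟨m, Nat.lt_succ_self m, S, hSA, hp, ?_, hmax⟩
        calc S.card ≤ ∑ i, (U i).card := Finset.card_biUnion_le
          _ ≤ ∑ _i : Fin m, c := Finset.sum_le_sum fun i _ => hc _ (hU i).1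
          _ = m * c := by simp
    · exact Or.inr ⟨s, hs.trans (Nat.lt_succ_self m), h⟩

/-- A set of at most `c` elements which can be replaced by a `Q`-set avoiding any prescribed
disjoint set of size at most `T`. -/
def Completable (Q : Finset V → Prop) (c T : ℕ) (U : Finset V) : Prop :=
  U.card ≤ c ∧ ∀ W : Finset V, W.card ≤ T → Disjoint U W → ∃ F, Q F ∧ Disjoint F W

/-- Disjoint completable sets can be replaced one after the other. -/
theorem HasPacking.of_completable [Fintype V] {Q : Finset V → Prop} {c t : ℕ}
    (hc : ∀ U, Q U → U.card ≤ c) {A : Finset V}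
    (h : HasPacking (Completable Q c ((t - 1) * c)) A t) : HasPacking Q Finset.univ t := by
  obtain ⟨U, hU, hd⟩ := h
  -- Here `s` holds the indices already replaced. Replaced or not, each set has at most c elements,
  -- so the other t-1 sets never exceed the allowed size (t-1)c.
  suffices H : ∀ s : Finset (Fin t), ∃ U' : Fin t → Finset V, (∀ i ∈ s, Q (U' i)) ∧
      (∀ i ∉ s, U' i = U i) ∧ Pairwise fun i j => Disjoint (U' i) (U' j) by
    obtain ⟨U', h1, -, h3⟩ := H Finset.univ
    exact ⟨U', fun i => ⟨h1 i (Finset.mem_univ i), Finset.subset_univ _⟩, h3⟩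
  intro s
  induction s using Finset.induction_on with
  | empty => exact ⟨U, by simp, by simp, hd⟩
  | insert a s ha ih =>
    obtain ⟨U', h1, h2, h3⟩ := ih
    have hcard : ∀ i, (U' i).card ≤ c := fun i => by
      by_cases hi : i ∈ s
      · exact hc _ (h1 i hi)
      · rw [h2 i hi]; exact (hU i).1.1
    obtain ⟨F, hQF, hF⟩ := (hU a).1.2 ((Finset.univ.erase a).biUnion U')
      (by
        calc _ ≤ ∑ i ∈ Finset.univ.erase a, (U' i).card := Finset.card_biUnion_le
          _ ≤ ∑ _i ∈ Finset.univ.erase a, c := Finset.sum_le_sum fun i _ => hcard i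
          _ = (t - 1) * c := by simp)
      (by
        rw [← h2 a ha, Finset.disjoint_biUnion_right]
        exact fun i hi => h3 (Finset.ne_of_mem_erase hi).symm)
    rw [Finset.disjoint_biUnion_right] at hF
    refine ⟨Function.update U' a F, fun i hi => ?_, fun i hi => ?_, fun i j hij => ?_⟩
    · rcases eq_or_ne i a with rfl | hia
      · simpa using hQF
      · rw [Function.update_of_ne hia]
        exact h1 i ((Finset.mem_insert.1 hi).resolve_left hia)
    · rw [Finset.mem_insert, not_or] at hi
      rw [Function.update_of_ne hi.1]
      exact h2 i hi.2
    · rcases eq_or_ne i a with rfl | hia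
      · rw [Function.update_self, Function.update_of_ne hij.symm]
        exact hF j (by simp [hij.symm])
      · rcases eq_or_ne j a with rfl | hja
        · rw [Function.update_self, Function.update_of_ne hia]
          exact (hF i (by simp [hia])).symm
        · rw [Function.update_of_ne hia, Function.update_of_ne hja]
          exact h3 hij

end Packing

/-! ### Fans, stars and matchings as vertex sets. -/

section Fans

variable {V : Type*} [DecidableEq V]

/-- `e` consists of the two endpoints of an edge of `G`. -/
def IsEdgePair (G : SimpleGraph V) (e : Finset V) : Prop := ∃ u v, G.Adj u v ∧ e = {u, v}

/-- `M` is the vertex set of a matching of `G` with `k` edges. -/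
def IsMatchingSet (G : SimpleGraph V) (k : ℕ) (M : Finset V) : Prop :=
  ∃ e : Fin k → Finset V, (∀ i, IsEdgePair G (e i)) ∧
    (Pairwise fun i j => Disjoint (e i) (e j)) ∧ M = Finset.univ.biUnion e

/-- `F` is the vertex set of a fan with `k` triangles in `G`. -/
def IsFanSet (G : SimpleGraph V) (k : ℕ) (F : Finset V) : Prop :=
  ∃ c M, IsMatchingSet G k M ∧ (∀ x ∈ M, G.Adj c x) ∧ F = insert c M

/-- `U` is the vertex set of a star with `k` edges in `G`. -/
def IsStarSet (G : SimpleGraph V) (k : ℕ) (U : Finset V) : Prop :=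
  ∃ c L, L.card = k ∧ (∀ x ∈ L, G.Adj c x) ∧ U = insert c L

variable {G : SimpleGraph V} {k : ℕ}

theorem IsEdgePair.card {e : Finset V} (h : IsEdgePair G e) : e.card ≤ 2 := by
  obtain ⟨u, v, -, rfl⟩ := h
  exact Finset.card_le_two

theorem IsMatchingSet.card {M : Finset V} (h : IsMatchingSet G k M) : M.card ≤ 2 * k := by
  obtain ⟨e, he, -, rfl⟩ := h
  calc _ ≤ ∑ i, (e i).card := Finset.card_biUnion_le
    _ ≤ ∑ _i : Fin k, 2 := Finset.sum_le_sum fun i _ => (he i).card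
    _ = 2 * k := by simp [mul_comm]

theorem IsFanSet.card {F : Finset V} (h : IsFanSet G k F) : F.card ≤ 2 * k + 1 := by
  obtain ⟨c, M, hM, -, rfl⟩ := h
  exact (Finset.card_insert_le _ _).trans (Nat.succ_le_succ hM.card)

theorem IsStarSet.card {U : Finset V} (h : IsStarSet G k U) : U.card ≤ k + 1 := by
  obtain ⟨c, L, hL, -, rfl⟩ := h
  exact hL ▸ Finset.card_insert_le _ _

theorem HasPacking.isMatchingSet {A : Finset V} (h : HasPacking (IsEdgePair G) A k) :
    ∃ M ⊆ A, IsMatchingSet G k M := by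
  obtain ⟨e, he, hd⟩ := h
  exact ⟨_, Finset.biUnion_subset.2 fun i _ => (he i).2, e, fun i => (he i).1, hd, rfl⟩

/-- A matching with `r * k` edges splits into `r` matchings with `k` edges. -/
theorem HasPacking.matchings {A : Finset V} {r : ℕ} (h : HasPacking (IsEdgePair G) A (r * k)) :
    HasPacking (IsMatchingSet G k) A r := by
  obtain ⟨e, he, hd⟩ := h
  refine ⟨fun j => Finset.univ.biUnion fun i => e (finProdFinEquiv (j, i)), fun j => ⟨⟨_,
    fun i => (he _).1, fun i i' hi => hd ?_, rfl⟩, Finset.biUnion_subset.2 fun i _ => (he _).2⟩,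
    fun j j' hj => ?_⟩
  · simpa using hi
  · simp only [Finset.disjoint_biUnion_left, Finset.disjoint_biUnion_right]
    intro i _ i' _
    exact hd (by simp [hj])

/-- The vertices of a fan as an injective image of the vertices of `graphFan k`. -/
theorem IsFanSet.exists_copy {F : Finset V} (h : IsFanSet G k F) :
    ∃ f : Fin 1 ⊕ (Fin k × Fin 2) → V, Function.Injective f ∧ (∀ x, f x ∈ F) ∧
      ∀ x y, (graphFan k).Adj x y → G.Adj (f x) (f y) := by
  obtain ⟨c, M, ⟨e, he, hd, rfl⟩, hc, rfl⟩ := h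
  choose u v huv heq using he
  let g : Fin k × Fin 2 → V := fun p => if p.2 = 0 then u p.1 else v p.1
  have hg : ∀ p, g p ∈ e p.1 := fun p => by
    simp only [g]; rw [heq]; split_ifs <;> simp
  have hgM : ∀ p, g p ∈ Finset.univ.biUnion e := fun p =>
    Finset.mem_biUnion.2 ⟨p.1, Finset.mem_univ _, hg p⟩
  have hgadj : ∀ i a b, a ≠ b → G.Adj (g (i, a)) (g (i, b)) := fun i a b hab => by
    fin_cases a <;> fin_cases b <;> simp [g] at hab ⊢
    · exact huv i
    · exact (huv i).symm
  refine ⟨Sum.elim (fun _ => c) g, ?_, ?_, ?_⟩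
  · refine Function.Injective.sumElim (Function.injective_of_subsingleton _) ?_ ?_
    · rintro ⟨i, a⟩ ⟨j, b⟩ hij
      have h1 : i = j := by
        by_contra hne
        exact Finset.disjoint_left.1 (hd hne) (hg (i, a)) (hij ▸ hg (j, b))
      subst h1
      by_contra hne
      exact (hgadj i a b (by simpa using hne)).ne hij
    · exact fun _ p => (hc _ (hgM p)).ne
  · rintro (x | x)
    · simp
    · exact Finset.mem_insert_of_mem (hgM x)
  · rintro (x | x) (y | y) hxy
    · simp [graphFan, graphJoin, Subsingleton.elim x y] at hxy
    · exact hc _ (hgM y)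
    · exact (hc _ (hgM x)).symm
    · obtain ⟨i, a⟩ := x
      obtain ⟨j, b⟩ := y
      have : i = j ∧ a ≠ b := by simpa [graphFan, graphJoin, graphCopies] using hxy
      obtain ⟨rfl, hab⟩ := this
      exact hgadj i a b hab

theorem HasPacking.isContained {A : Finset V} {t : ℕ} (h : HasPacking (IsFanSet G k) A t) :
    (graphCopies t (graphFan k)).IsContained G := by
  obtain ⟨U, hU, hd⟩ := h
  choose f hinj hmem hadj using fun i => (hU i).1.exists_copy
  refine ⟨⟨⟨fun p => f p.1 p.2, ?_⟩, ?_⟩⟩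
  · rintro ⟨i, x⟩ ⟨j, y⟩ ⟨hij, hxy⟩
    obtain rfl : i = j := hij
    exact hadj i x y hxy
  · rintro ⟨i, x⟩ ⟨j, y⟩ hij
    replace hij : f i x = f j y := hij
    have h1 : i = j := by
      by_contra hne
      exact Finset.disjoint_left.1 (hd hne) (hmem i x) (hij ▸ hmem j y)
    subst h1
    rw [hinj i hij]

end Fans

/-! ### Seeds of fans inside one side of an almost bipartition. -/

section Side

variable {V : Type*}

open Classical in
/-- The neighbours of `v` inside `A`. -/
noncomputable def nbrsIn (G : SimpleGraph V) (A : Finset V) (v : V) : Finset V :=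
  A.filter (G.Adj v)

variable {G : SimpleGraph V} {k : ℕ}

@[simp]
theorem mem_nbrsIn {A : Finset V} {v x : V} : x ∈ nbrsIn G A v ↔ x ∈ A ∧ G.Adj v x := by
  simp [nbrsIn]

theorem nbrsIn_subset (A : Finset V) (v : V) : nbrsIn G A v ⊆ A := fun _ hx =>
  (mem_nbrsIn.1 hx).1

theorem nbrsIn_mono {A B : Finset V} (h : A ⊆ B) (v : V) : nbrsIn G A v ⊆ nbrsIn G B v :=
  fun _ hx => mem_nbrsIn.2 ⟨h (mem_nbrsIn.1 hx).1, (mem_nbrsIn.1 hx).2⟩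

/-- Double counting the edges between two vertex sets. -/
theorem sum_card_nbrsIn_comm (A B : Finset V) :
    ∑ v ∈ A, (nbrsIn G B v).card = ∑ w ∈ B, (nbrsIn G A w).card := by
  classical
  have := Finset.sum_card_bipartiteAbove_eq_sum_card_bipartiteBelow (s := A) (t := B) G.Adj
  simpa only [Finset.bipartiteAbove, Finset.bipartiteBelow, nbrsIn, G.adj_comm] using this

variable [DecidableEq V]

theorem card_nbrsIn_union_le (A B : Finset V) (v : V) :
    (nbrsIn G (A ∪ B) v).card ≤ (nbrsIn G A v).card + (nbrsIn G B v).card := by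
  classical
  rw [nbrsIn, Finset.filter_union]
  exact Finset.card_union_le _ _

/-- W and the non-neighbourhoods of the at most 2k vertices of M are together too small to cover B;
any uncovered vertex serves as the centre. -/
theorem IsMatchingSet.completable {M B : Finset V} {d T : ℕ} (hM : IsMatchingSet G k M)
    (hd : ∀ v ∈ M, B.card ≤ (nbrsIn G B v).card + d) (hB : T + 2 * k * d < B.card) :
    Completable (IsFanSet G k) (2 * k + 1) T M := by
  refine ⟨hM.card.trans (Nat.le_succ _), fun W hW hMW => ?_⟩
  by_cases hy : ∃ y ∈ B, y ∉ W ∧ ∀ v ∈ M, G.Adj y v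
  · obtain ⟨y, -, hyW, hy⟩ := hy
    exact ⟨insert y M, ⟨y, M, hM, hy, rfl⟩, Finset.disjoint_insert_left.2 ⟨hyW, hMW⟩⟩
  · push Not at hy
    have hsub : B ⊆ W ∪ M.biUnion fun v => B \ nbrsIn G B v := fun y hyB => by
      by_cases hyW : y ∈ W
      · exact Finset.mem_union_left _ hyW
      · obtain ⟨v, hv, hyv⟩ := hy y hyB hyW
        refine Finset.mem_union_right _ (Finset.mem_biUnion.2 ⟨v, hv, ?_⟩)
        simp only [Finset.mem_sdiff, mem_nbrsIn, not_and]
        exact ⟨hyB, fun _ h => hyv h.symm⟩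
    have h1 : (M.biUnion fun v => B \ nbrsIn G B v).card ≤ M.card * d :=
      Finset.card_biUnion_le_card_mul _ _ _ fun v hv => by
        rw [Finset.card_sdiff_of_subset (nbrsIn_subset B v)]
        have := hd v hv
        omega
    have h2 := (Finset.card_le_card hsub).trans (Finset.card_union_le _ _)
    have h3 : M.card * d ≤ 2 * k * d := Nat.mul_le_mul_right _ hM.card
    omega

/-- The centre and any leaf have at least |B|-2d common neighbours in B, hence at least k outside W.
Hall's theorem then picks distinct third vertices for the k triangles. -/
theorem IsStarSet.completable {A B U : Finset V} {d T : ℕ} (hU : IsStarSet G k U) (hUA : U ⊆ A)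
    (hAB : Disjoint A B) (hd : ∀ v ∈ U, B.card ≤ (nbrsIn G B v).card + d)
    (hB : T + k + 2 * d ≤ B.card) : Completable (IsFanSet G k) (2 * k + 1) T U := by
  refine ⟨hU.card.trans (by omega), fun W hW hUW => ?_⟩
  obtain ⟨c, L, hLk, hc, rfl⟩ := hU
  let l : Fin k → V := fun i => (L.equivFinOfCardEq hLk).symm i
  have hlL : ∀ i, l i ∈ L := fun i => ((L.equivFinOfCardEq hLk).symm i).2
  have hl : Function.Injective l :=
    Subtype.val_injective.comp (L.equivFinOfCardEq hLk).symm.injective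
  let Y : Fin k → Finset V := fun i => (nbrsIn G B c ∩ nbrsIn G B (l i)) \ W
  have hY : ∀ i, k ≤ (Y i).card := fun i => by
    have h1 := hd c (Finset.mem_insert_self _ _)
    have h2 := hd (l i) (Finset.mem_insert_of_mem (hlL i))
    have h3 := Finset.card_union_add_card_inter (nbrsIn G B c) (nbrsIn G B (l i))
    have h4 := Finset.card_le_card
      (Finset.union_subset (nbrsIn_subset (G := G) B c) (nbrsIn_subset (G := G) B (l i)))
    have h5 := Finset.le_card_sdiff W (nbrsIn G B c ∩ nbrsIn G B (l i))
    simp only [Y]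
    omega
  obtain ⟨y, hy, hyY⟩ := (Finset.all_card_le_biUnion_card_iff_exists_injective Y).1 fun s => by
    rcases s.eq_empty_or_nonempty with rfl | ⟨i, hi⟩
    · simp
    · calc s.card ≤ k := by simpa using Finset.card_le_univ s
        _ ≤ (Y i).card := hY i
        _ ≤ _ := Finset.card_le_card (Finset.subset_biUnion_of_mem Y hi)
  have hyY' : ∀ i, y i ∈ B ∧ G.Adj c (y i) ∧ G.Adj (l i) (y i) ∧ y i ∉ W := fun i => by
    have := hyY i
    simp only [Y, Finset.mem_sdiff, Finset.mem_inter, mem_nbrsIn] at this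
    tauto
  have hly : ∀ i j, l i ≠ y j := fun i j h =>
    Finset.disjoint_left.1 hAB (hUA (Finset.mem_insert_of_mem (hlL i))) (h ▸ (hyY' j).1)
  rw [Finset.disjoint_insert_left] at hUW
  refine ⟨_, ⟨c, _, ⟨fun i => {l i, y i}, fun i => ⟨_, _, (hyY' i).2.2.1, rfl⟩,
    fun i j hij => ?_, rfl⟩, fun x hx => ?_, rfl⟩, ?_⟩
  · have h1 : l j ≠ l i := hl.ne hij.symm
    have h2 : y j ≠ y i := hy.ne hij.symm
    simp [h1, h2, hly j i, (hly i j).symm]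
  · simp only [Finset.mem_biUnion, Finset.mem_univ, true_and, Finset.mem_insert,
      Finset.mem_singleton] at hx
    obtain ⟨i, rfl | rfl⟩ := hx
    · exact hc _ (hlL i)
    · exact (hyY' i).2.1
  · rw [Finset.disjoint_insert_left, Finset.disjoint_biUnion_left]
    refine ⟨hUW.1, fun i _ => ?_⟩
    simp only [Finset.disjoint_insert_left, Finset.disjoint_singleton_left]
    exact ⟨Finset.disjoint_left.1 hUW.2 (hlL i), (hyY' i).2.2.2⟩

/-- A graph on `A` with minimum degree at least `m` and bounded maximum degree contains `m`
disjoint stars and matchings, the matchings avoiding large degrees. -/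
theorem exists_stars_matchings {A : Finset V} {m t L : ℕ} (hk : 1 ≤ k) (hm : m ≤ t)
    (hL : L ≤ 2 * t * k + t) (hA : 2 * t * k ^ 2 + 6 * t * k ≤ A.card)
    (hmin : ∀ v ∈ A, m ≤ (nbrsIn G A v).card) (hmax : ∀ v ∈ A, (nbrsIn G A v).card ≤ L) :
    HasPacking (IsStarSet G k) A m ∨ ∃ s < m, ∃ S ⊆ A, HasPacking (IsStarSet G k) S s ∧
      HasPacking (IsMatchingSet G k) (A \ S) (m - s) ∧
      ∀ v ∈ A \ S, (nbrsIn G A v).card + 1 ≤ s * (k + 1) + k := by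
  refine (HasPacking.or_maximal (IsStarSet G k) (fun _ h => h.card) A m).imp_right ?_
  rintro ⟨s, hs, S, hSA, hS, hScard, hSmax⟩
  have hlow : ∀ v ∈ A \ S, (nbrsIn G (A \ S) v).card + 1 ≤ k := fun v hv => by
    by_contra! h
    obtain ⟨L', hL', hL'k⟩ := Finset.exists_subset_card_eq (Nat.lt_succ_iff.1 h)
    exact hSmax (insert v L') (Finset.insert_subset hv (hL'.trans (nbrsIn_subset _ _)))
      ⟨v, L', hL'k, fun x hx => (mem_nbrsIn.1 (hL' hx)).2, rfl⟩
  refine ⟨s, hs, S, hSA, hS, ?_, fun v hv => ?_⟩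
  swap
  · have h1 := card_nbrsIn_union_le (G := G) S (A \ S) v
    rw [Finset.union_sdiff_of_subset hSA] at h1
    have h2 := Finset.card_le_card (nbrsIn_subset (G := G) S v)
    have h3 := hlow v hv
    omega
  rcases HasPacking.or_maximal (IsEdgePair G) (fun _ h => h.card) (A \ S) ((m - s) * k) with
    h | ⟨q, hq, C, hCA, -, hCcard, hCmax⟩
  · exact h.matchings
  exfalso
  -- By maximality of the matching R is independent, so every vertex of R sends at least m edges to
  -- S ∪ C. Double counting these edges gives the contradiction.
  set R := (A \ S) \ C with hR
  have hRAS : R ⊆ A \ S := Finset.sdiff_subset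
  have hRA : R ⊆ A := hRAS.trans Finset.sdiff_subset
  have hdegR : ∀ u ∈ R, m ≤ (nbrsIn G (S ∪ C) u).card := fun u hu => by
    refine (hmin u (hRA hu)).trans (Finset.card_le_card fun x hx => ?_)
    rw [mem_nbrsIn] at hx ⊢
    refine ⟨?_, hx.2⟩
    by_contra hxSC
    rw [Finset.mem_union, not_or] at hxSC
    have hxR : x ∈ R := by simp [hR, hx.1, hxSC.1, hxSC.2]
    refine hCmax {u, x} ?_ ⟨u, x, hx.2, rfl⟩
    simp [Finset.insert_subset_iff, hu, hxR]
  have hcount : R.card * m ≤ S.card * L + C.card * (k - 1) := by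
    calc R.card * m = ∑ _u ∈ R, m := by simp
      _ ≤ ∑ u ∈ R, (nbrsIn G (S ∪ C) u).card := Finset.sum_le_sum hdegR
      _ = ∑ w ∈ S ∪ C, (nbrsIn G R w).card := sum_card_nbrsIn_comm _ _
      _ ≤ ∑ w ∈ S, (nbrsIn G R w).card + ∑ w ∈ C, (nbrsIn G R w).card := by
        rw [← Finset.sum_union_inter]; exact Nat.le_add_right _ _
      _ ≤ ∑ _w ∈ S, L + ∑ _w ∈ C, (k - 1) := by
        refine Nat.add_le_add (Finset.sum_le_sum fun w hw => ?_) (Finset.sum_le_sum fun w hw => ?_)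
        · exact (Finset.card_le_card (nbrsIn_mono hRA w)).trans (hmax w (hSA hw))
        · have h1 := hlow w (hCA hw)
          have h2 := Finset.card_le_card (nbrsIn_mono (G := G) hRAS w)
          omega
      _ = _ := by simp
  obtain ⟨p, rfl⟩ : ∃ p, m = s + p := ⟨m - s, by omega⟩
  obtain ⟨j, rfl⟩ : ∃ j, k = j + 1 := ⟨k - 1, by omega⟩
  simp only [Nat.add_sub_cancel_left, Nat.add_sub_cancel] at hq hcount
  have hRcard : A.card ≤ R.card + S.card + C.card := by
    have h1 := Finset.le_card_sdiff S A
    have h2 := Finset.le_card_sdiff C (A \ S)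
    rw [← hR] at h2
    omega
  have hC : C.card ≤ 2 * p * (j + 1) := by nlinarith
  have hSC : S.card + C.card ≤ 2 * t * (j + 1) := by nlinarith
  -- K is a lower bound for |R| with (k+1)L ≤ K and 2k(k-1) < K. So S receives at most sK edges and
  -- C fewer than pK, in total less than mK ≤ m|R|.
  set K := 2 * t * (j + 1) ^ 2 + 4 * t * (j + 1) with hK
  have hRK : K ≤ R.card := by nlinarith
  have ht : 1 ≤ t := by omega
  have hp : 1 ≤ p := by omega
  have h1 : (j + 1 + 1) * L ≤ K :=
    (Nat.mul_le_mul_left _ hL).trans (by rw [hK]; nlinarith)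
  have h2 : 2 * (j + 1) * j + 1 ≤ K := by
    rw [hK]; nlinarith [Nat.mul_le_mul_right ((j + 1) ^ 2) ht]
  have h3 : S.card * L ≤ s * K :=
    (Nat.mul_le_mul_right _ hScard).trans (by rw [mul_assoc]; exact Nat.mul_le_mul_left _ h1)
  have h4 : C.card * j ≤ p * (2 * (j + 1) * j) :=
    (Nat.mul_le_mul_right _ hC).trans (le_of_eq (by ring))
  have h5 : p * (2 * (j + 1) * j + 1) ≤ p * K := Nat.mul_le_mul_left _ h2
  have h6 : K * (s + p) ≤ R.card * (s + p) := Nat.mul_le_mul_right _ hRK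
  nlinarith

/-- Since |B| ≤ D-m, each vertex of A has at least m neighbours in A, so `exists_stars_matchings`
applies. Small inner degrees mean that few vertices of B are missed, which makes the stars and
matchings completable. -/
theorem packing_completable_of_side {A B : Finset V} {n t D L T m : ℕ} (hAB : Disjoint A B)
    (hk : 1 ≤ k) (hm : m ≤ t) (hL : L + 3 ≤ 2 * t * k + t) (hT : T + 3 ≤ 2 * t * k + t)
    (hn : 12 * t * k + 2 * k ≤ n) (hn' : 4 * t * k ^ 2 ≤ n) (hD : n ≤ D)
    (hcard : A.card + B.card + 1 = D + n) (hB : 0 < m → B.card + m ≤ D)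
    (hmin : ∀ v ∈ A, D ≤ (nbrsIn G A v).card + (nbrsIn G B v).card)
    (hmax : ∀ v ∈ A, (nbrsIn G A v).card ≤ L) :
    HasPacking (Completable (IsFanSet G k) (2 * k + 1) T) A m := by
  rcases Nat.eq_zero_or_pos m with rfl | hm0
  · exact .zero _ _
  replace hB := hB hm0
  have hA : n ≤ A.card := by omega
  have htk : t ≤ t * k := Nat.le_mul_of_pos_right _ hk
  obtain ⟨v₀, hv₀⟩ : A.Nonempty := Finset.card_pos.1 (by omega)
  have hBlow : D ≤ B.card + L := by
    have h1 := hmin v₀ hv₀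
    have h2 := hmax v₀ hv₀
    have h3 := Finset.card_le_card (nbrsIn_subset (G := G) B v₀)
    omega
  have hstar : ∀ U ⊆ A, IsStarSet G k U → Completable (IsFanSet G k) (2 * k + 1) T U :=
    fun U hU h => h.completable hU hAB (d := L)
      (fun v hv => by have h1 := hmin v (hU hv); have h2 := hmax v (hU hv); omega)
      (by nlinarith)
  rcases exists_stars_matchings (G := G) hk hm (show L ≤ 2 * t * k + t by omega) (by nlinarith)
    (fun v hv => by
      have h1 := hmin v hv
      have h3 := Finset.card_le_card (nbrsIn_subset (G := G) B v)
      omega) hmax with h | ⟨s, hs, S, hSA, hS, hM, hlow⟩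
  · exact h.mono subset_rfl hstar
  · have h1 := hS.mono subset_rfl fun U hU => hstar U (hU.trans hSA)
    -- Outside S the inner degree is at most (s+1)(k+1)-2 ≤ m(k+1)-2, and |B| ≤ D-m, so fewer than
    -- mk vertices of B are missed. The resulting 2k·mk ≤ 2tk² is where n ≥ 4tk² is used.
    have h2 := hM.mono subset_rfl fun U hU hUM => hUM.completable (B := B) (d := m * k) (T := T)
      (fun v hv => by
        have h1 := hlow v (hU hv)
        have h2 := hmin v (Finset.mem_sdiff.1 (hU hv)).1
        have h3 : (s + 1) * (k + 1) ≤ m * (k + 1) := Nat.mul_le_mul_right _ hs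
        nlinarith)
      (by
        have : m * (2 * k ^ 2) ≤ t * (2 * k ^ 2) := Nat.mul_le_mul_right _ hm
        nlinarith)
    have h3 := h1.add h2 Finset.disjoint_sdiff
    rwa [Finset.union_sdiff_of_subset hSA, Nat.add_sub_cancel' hs.le] at h3

end Side

/-! ### Almost bipartite structure and the minimum degree theorem. -/

section Dense

variable {V : Type*} [DecidableEq V] {G : SimpleGraph V} {k : ℕ}

/-- The neighbourhood of a vertex which is not robustly the centre of a fan is almost
independent. -/
theorem exists_independent_of_not_completable {T : ℕ} {v : V}
    (hv : ¬ Completable (IsFanSet G k) (2 * k + 1) T {v}) (A : Finset V) :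
    ∃ I ⊆ nbrsIn G A v, (∀ x ∈ I, ∀ y ∈ I, ¬ G.Adj x y) ∧
      (nbrsIn G A v).card ≤ I.card + (T + 2 * (k - 1)) := by
  simp only [Completable, not_and, not_forall, not_exists, Finset.card_singleton,
    Finset.disjoint_singleton_left] at hv
  obtain ⟨W, hWT, hvW, hW⟩ := hv (Nat.succ_le_succ (Nat.zero_le _))
  -- A k-edge matching here would form a fan with centre v avoiding W. Hence a maximal matching
  -- covers at most 2(k-1) vertices, and removing them leaves an independent set.
  rcases HasPacking.or_maximal (IsEdgePair G) (fun _ h => h.card) (nbrsIn G A v \ W) k with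
    h | ⟨q, hq, C, -, -, hC, hmax⟩
  · obtain ⟨M, hMA, hM⟩ := h.isMatchingSet
    refine (hW (insert v M) ⟨v, M, hM, fun x hx => ?_, rfl⟩ ?_).elim
    · exact (mem_nbrsIn.1 (Finset.mem_sdiff.1 (hMA hx)).1).2
    · exact Finset.disjoint_insert_left.2 ⟨hvW, Finset.disjoint_of_subset_left hMA
        Finset.sdiff_disjoint⟩
  · refine ⟨(nbrsIn G A v \ W) \ C, Finset.sdiff_subset.trans Finset.sdiff_subset,
      fun x hx y hy hxy => ?_, ?_⟩
    · refine hmax {x, y} ?_ ⟨x, y, hxy, rfl⟩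
      rw [Finset.insert_subset_iff, Finset.singleton_subset_iff]
      exact ⟨hx, hy⟩
    · have h1 := Finset.le_card_sdiff W (nbrsIn G A v)
      have h2 := Finset.le_card_sdiff C (nbrsIn G A v \ W)
      omega

/-- If all neighbourhoods are almost independent and the minimum degree is about half of the
number of vertices, then the graph is almost bipartite. -/
theorem exists_almost_bipartition {S : Finset V} {n D L : ℕ} (hD : n ≤ D) (hL : 4 * L ≤ n)
    (hcard : S.card + 1 = D + n) (hmin : ∀ v ∈ S, D ≤ (nbrsIn G S v).card)
    (hI : ∀ v ∈ S, ∃ I ⊆ nbrsIn G S v, (∀ x ∈ I, ∀ y ∈ I, ¬ G.Adj x y) ∧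
      (nbrsIn G S v).card ≤ I.card + L) :
    ∃ A B, Disjoint A B ∧ A ∪ B = S ∧ (∀ v ∈ A, (nbrsIn G A v).card ≤ L) ∧
      ∀ v ∈ B, (nbrsIn G B v).card ≤ L := by
  classical
  rcases S.eq_empty_or_nonempty with rfl | ⟨v₀, hv₀⟩
  · exact ⟨∅, ∅, by simp⟩
  choose! I hIsub hIind hIcard using hI
  have hIS : ∀ v ∈ S, I v ⊆ S := fun v hv => (hIsub v hv).trans (nbrsIn_subset _ _)
  have hbig : ∀ v ∈ S, D ≤ (I v).card + L := fun v hv => (hmin v hv).trans (hIcard v hv)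
  -- A common element x has no neighbour in either set, and its degree is at least D, so only n-1
  -- vertices remain for the union.
  have hunion : ∀ v ∈ S, ∀ w ∈ S, ¬ Disjoint (I v) (I w) → (I v ∪ I w).card + 1 ≤ n := by
    intro v hv w hw h
    obtain ⟨x, hxv, hxw⟩ := Finset.not_disjoint_iff.1 h
    have hdisj : Disjoint (I v ∪ I w) (nbrsIn G S x) := by
      rw [Finset.disjoint_left]
      intro y hy hy'
      have hxy := (mem_nbrsIn.1 hy').2
      rcases Finset.mem_union.1 hy with hy | hy
      · exact hIind v hv x hxv y hy hxy
      · exact hIind w hw x hxw y hy hxy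
    have h1 := Finset.card_le_card (Finset.union_subset
      (Finset.union_subset (hIS v hv) (hIS w hw)) (nbrsIn_subset (G := G) S x))
    rw [Finset.card_union_of_disjoint hdisj] at h1
    have h2 := hmin x (hIS v hv hxv)
    omega
  -- A neighbour w of v in A lies outside I(v): otherwise a common element of I(v) and I(w) would be
  -- adjacent to w inside the independent set I(v).
  have hdeg : ∀ A ⊆ S, (∀ v ∈ A, ∀ w ∈ A, ¬ Disjoint (I v) (I w)) →
      ∀ v ∈ A, (nbrsIn G A v).card ≤ L := by
    intro A hA h v hv
    have hdisj : Disjoint (I v) (nbrsIn G A v) := by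
      rw [Finset.disjoint_left]
      intro w hw hw'
      refine h v hv w (mem_nbrsIn.1 hw').1 (Finset.disjoint_left.2 fun x hx hx' => ?_)
      exact hIind v (hA hv) w hw x hx
        (mem_nbrsIn.1 (hIsub w (hA (mem_nbrsIn.1 hw').1) hx')).2
    have h1 := Finset.card_le_card (Finset.union_subset (hIsub v (hA hv))
      (nbrsIn_mono (G := G) hA v))
    rw [Finset.card_union_of_disjoint hdisj] at h1
    have h2 := hIcard v (hA hv)
    omega
  -- The sets I(v) have size at least n-L and are pairwise disjoint or nearly equal. Two that meet
  -- I(v₀) cannot be disjoint, as both contain most of I(v₀); two that miss it cannot be disjoint,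
  -- as three such sets do not fit into S.
  refine ⟨S.filter fun v => ¬ Disjoint (I v) (I v₀), S.filter fun v => ¬ ¬ Disjoint (I v) (I v₀),
    Finset.disjoint_filter_filter_not _ _ _, Finset.filter_union_filter_not_eq _ _,
    hdeg _ (Finset.filter_subset _ _) fun v hv w hw h => ?_,
    hdeg _ (Finset.filter_subset _ _) fun v hv w hw h => ?_⟩
  · rw [Finset.mem_filter] at hv hw
    have h1 := hunion v hv.1 v₀ hv₀ hv.2
    have h2 := hunion w hw.1 v₀ hv₀ hw.2
    have h3 := Finset.card_union_add_card_inter (I v) (I v₀)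
    have h4 := Finset.card_union_add_card_inter (I w) (I v₀)
    have h5 : Disjoint (I v ∩ I v₀) (I w ∩ I v₀) :=
      h.mono Finset.inter_subset_left Finset.inter_subset_left
    have h6 := Finset.card_le_card (Finset.union_subset
      (Finset.inter_subset_right (s₁ := I v) (s₂ := I v₀))
      (Finset.inter_subset_right (s₁ := I w) (s₂ := I v₀)))
    rw [Finset.card_union_of_disjoint h5] at h6
    have h7 := Finset.card_le_card (Finset.subset_union_right (s₁ := I v) (s₂ := I v₀))
    have h8 := hbig v hv.1
    have h9 := hbig w hw.1
    have h10 := hbig v₀ hv₀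
    omega
  · rw [Finset.mem_filter, not_not] at hv hw
    have h1 := Finset.card_le_card (Finset.union_subset
      (Finset.union_subset (hIS v hv.1) (hIS w hw.1)) (hIS v₀ hv₀))
    rw [Finset.card_union_of_disjoint (Finset.disjoint_union_left.2 ⟨hv.2, hw.2⟩),
      Finset.card_union_of_disjoint h] at h1
    have h8 := hbig v hv.1
    have h9 := hbig w hw.1
    have h10 := hbig v₀ hv₀
    have : S.card ≠ 0 := Finset.card_ne_zero_of_mem hv₀
    omega

/-- A graph on `2n + t - 2` vertices with minimum degree at least `n + t - 1` contains `t`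
disjoint fans. -/
theorem graphCopies_graphFan_isContained_of_minDegree [Fintype V] {n t : ℕ} (hk : 1 ≤ k)
    (ht : 1 ≤ t) (hn : 12 * t * k + 2 * k ≤ n) (hn' : 4 * t * k ^ 2 ≤ n)
    (hcard : Fintype.card V + 2 = 2 * n + t)
    (hmin : ∀ v, n + t ≤ (nbrsIn G Finset.univ v).card + 1) :
    (graphCopies t (graphFan k)).IsContained G := by
  classical
  set T := (t - 1) * (2 * k + 1) with hT
  have hT' : T + 2 * k + 1 = 2 * t * k + t := by
    obtain ⟨s, rfl⟩ : ∃ s, t = s + 1 := ⟨t - 1, by omega⟩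
    rw [hT, Nat.add_sub_cancel]
    ring
  have htk : t ≤ t * k := Nat.le_mul_of_pos_right _ hk
  rw [mul_assoc] at hn hT'
  suffices H : ∃ A, HasPacking (Completable (IsFanSet G k) (2 * k + 1) T) A t from
    (HasPacking.of_completable (fun _ h => h.card) H.choose_spec).isContained
  set X := Finset.univ.filter fun v => Completable (IsFanSet G k) (2 * k + 1) T {v} with hX
  have hXpack : HasPacking (Completable (IsFanSet G k) (2 * k + 1) T) X X.card :=
    .singletons fun v hv => (Finset.mem_filter.1 hv).2
  rcases le_or_gt t X.card with htX | htX
  · exact ⟨X, hXpack.of_le htX⟩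
  obtain ⟨r, hr⟩ : ∃ r, t = X.card + r := ⟨t - X.card, by omega⟩
  have hXc : (Xᶜ).card + X.card = Fintype.card V := by
    rw [add_comm]; exact Finset.card_add_card_compl X
  -- Deleting X leaves D+n-1 vertices and minimum degree at least D = n+r-1.
  obtain ⟨D, hD⟩ : ∃ D, n + r = D + 1 := ⟨n + r - 1, by omega⟩
  have hminX : ∀ v, D ≤ (nbrsIn G Xᶜ v).card := fun v => by
    have h1 := card_nbrsIn_union_le (G := G) X Xᶜ v
    rw [Finset.union_compl] at h1
    have h2 := hmin v
    have h3 := Finset.card_le_card (nbrsIn_subset (G := G) X v)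
    omega
  set L := T + 2 * (k - 1) with hL
  obtain ⟨A, B, hAB, hABX, hA, hB⟩ := exists_almost_bipartition (G := G) (S := Xᶜ) (n := n)
    (D := D) (L := L) (by omega) (by omega) (by omega) (fun v _ => hminX v)
    fun v hv => exists_independent_of_not_completable (by simpa [hX] using hv) _
  have hABcard : A.card + B.card = (Xᶜ).card := by
    rw [← hABX, Finset.card_union_of_disjoint hAB]
  have hminAB : ∀ v, D ≤ (nbrsIn G A v).card + (nbrsIn G B v).card := fun v =>
    (hminX v).trans (hABX ▸ card_nbrsIn_union_le A B v)
  -- As (D-|A|)+(D-|B|) = r over the integers, the r seeds can be shared between the sides. The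
  -- minimum with r and truncated subtraction cover the case where one difference is negative.
  have hpA := packing_completable_of_side (G := G) (t := t) (T := T) (m := min (D - B.card) r)
    (n := n) (D := D) (L := L) hAB hk (by omega) (by rw [mul_assoc]; omega)
    (by rw [mul_assoc]; omega) (by rw [mul_assoc]; exact hn) hn' (by omega) (by omega) (by omega)
    (fun v _ => hminAB v) hA
  have hpB := packing_completable_of_side (G := G) (t := t) (T := T)
    (m := r - min (D - B.card) r)
    (n := n) (D := D) (L := L) hAB.symm hk (by omega) (by rw [mul_assoc]; omega)
    (by rw [mul_assoc]; omega) (by rw [mul_assoc]; exact hn) hn' (by omega) (by omega) (by omega)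
    (fun v _ => by rw [add_comm]; exact hminAB v) hB
  have h := hXpack.add (hpA.add hpB hAB) (hABX ▸ disjoint_compl_right)
  rw [Nat.add_sub_cancel' (min_le_right _ _), ← hr] at h
  exact ⟨_, h⟩

end Dense

/-! ### Stars from large degrees. -/

section Star

theorem graphStar_isContained_of_le_card {V : Type*} [Fintype V] {G : SimpleGraph V} {m : ℕ}
    {v : V} (h : m ≤ (nbrsIn G Finset.univ v).card) : (graphStar m).IsContained G := by
  obtain ⟨L, hL, hLm⟩ := Finset.exists_subset_card_eq h
  let l : Fin m → V := fun i => (L.equivFinOfCardEq hLm).symm i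
  have hl : Function.Injective l :=
    Subtype.val_injective.comp (L.equivFinOfCardEq hLm).symm.injective
  have hadj : ∀ i, G.Adj v (l i) := fun i =>
    (mem_nbrsIn.1 (hL ((L.equivFinOfCardEq hLm).symm i).2)).2
  refine ⟨⟨⟨Sum.elim (fun _ => v) l, ?_⟩, ?_⟩⟩
  · rintro (x | x) (y | y) hxy
    · simp [graphStar] at hxy
    · exact hadj y
    · exact (hadj x).symm
    · simp [graphStar] at hxy
  · exact (Function.injective_of_subsingleton _).sumElim hl fun _ i => (hadj i).ne

theorem graphStar_connected (m : ℕ) : (graphStar m).Connected := by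
  rw [connected_iff_exists_forall_reachable]
  refine ⟨Sum.inl 0, ?_⟩
  rintro (x | x)
  · rw [Subsingleton.elim x 0]
  · exact Adj.reachable (by simp [graphStar])

end Star

/-! ### Chromatic number and chromatic surplus of tF_k. -/

section Coloring

variable {k t : ℕ}

/-- The vertices of a triangle in the `i`-th copy of the fan. -/
def fanTriangle (hk : 0 < k) (i : Fin t) : Fin 3 → Fin t × (Fin 1 ⊕ (Fin k × Fin 2)) :=
  ![(i, Sum.inl 0), (i, Sum.inr (⟨0, hk⟩, 0)), (i, Sum.inr (⟨0, hk⟩, 1))]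

theorem fanTriangle_fst (hk : 0 < k) (i : Fin t) (a : Fin 3) : (fanTriangle hk i a).1 = i := by
  fin_cases a <;> rfl

theorem fanTriangle_adj (hk : 0 < k) (i : Fin t) {a b : Fin 3} (hab : a ≠ b) :
    (graphCopies t (graphFan k)).Adj (fanTriangle hk i a) (fanTriangle hk i b) := by
  fin_cases a <;> fin_cases b <;>
    simp [fanTriangle, graphCopies, graphFan, graphJoin] at hab ⊢

/-- In a proper colouring with three colours every copy of the fan meets every colour class. -/
theorem exists_fst_eq_color_eq (hk : 0 < k) (C : (graphCopies t (graphFan k)).Coloring (Fin 3))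
    (i : Fin t) (a : Fin 3) : ∃ v, v.1 = i ∧ C v = a := by
  have hinj : Function.Injective fun b => C (fanTriangle hk i b) := fun b b' h => by
    by_contra hne
    exact C.valid (fanTriangle_adj hk i hne) h
  obtain ⟨b, hb⟩ := Finite.surjective_of_injective hinj a
  exact ⟨_, fanTriangle_fst hk i b, hb⟩

theorem le_ncard_colorClass (hk : 0 < k) (C : (graphCopies t (graphFan k)).Coloring (Fin 3))
    (a : Fin 3) : t ≤ (C.colorClass a).ncard := by
  choose v hv hva using fun i => exists_fst_eq_color_eq hk C i a
  have hinj : Function.Injective v := fun i j h => by rw [← hv i, ← hv j, h]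
  calc t = (Set.range v).ncard := by
        rw [Set.ncard_range_of_injective hinj, Nat.card_fin]
    _ ≤ _ := Set.ncard_le_ncard (by rintro _ ⟨i, rfl⟩; exact hva i) (Set.toFinite _)

/-- The colouring of `tF_k` in which the centres form a colour class. -/
def fanColoring (k t : ℕ) : (graphCopies t (graphFan k)).Coloring (Fin 3) :=
  Coloring.mk (fun v => Sum.elim (fun _ => 0) (fun p => p.2.succ) v.2) <| by
    rintro ⟨i, x | x⟩ ⟨j, y | y⟩ ⟨-, h⟩ <;> simp [graphFan, graphJoin, graphCopies] at h ⊢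
    · exact h (Subsingleton.elim _ _)
    · exact (Fin.succ_ne_zero _).symm
    · exact h.2

theorem ncard_colorClass_fanColoring (k t : ℕ) :
    ((fanColoring k t).colorClass 0).ncard = t := by
  have : (fanColoring k t).colorClass 0 = Set.range fun i => (i, Sum.inl 0) := by
    ext ⟨i, x | x⟩
    · exact iff_of_true rfl ⟨i, by rw [Subsingleton.elim x 0]⟩
    · exact iff_of_false (Fin.succ_ne_zero x.2) (by simp)
  rw [this, Set.ncard_range_of_injective fun i j h => (Prod.ext_iff.1 h).1, Nat.card_fin]

theorem chromaticNumber_graphCopies_graphFan (hk : 0 < k) (ht : 0 < t) :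
    (graphCopies t (graphFan k)).chromaticNumber = 3 := by
  refine (chromaticNumber_eq_iff_colorable_not_colorable (n := 2)).2 ⟨⟨fanColoring k t⟩, ?_⟩
  rintro ⟨C⟩
  -- A 2-colouring read as a 3-colouring never uses the last colour, yet every fan must.
  let C' : (graphCopies t (graphFan k)).Coloring (Fin 3) :=
    Coloring.mk (fun v => (C v).castSucc) fun h h' => C.valid h (Fin.castSucc_injective _ h')
  obtain ⟨v, -, hv⟩ := exists_fst_eq_color_eq hk C' ⟨0, ht⟩ (Fin.last 2)
  exact (Fin.castSucc_lt_last _).ne hv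

theorem chromaticSurplus_graphCopies_graphFan (hk : 0 < k) (ht : 0 < t) :
    chromaticSurplus (graphCopies t (graphFan k)) = t := by
  rw [chromaticSurplus, chromaticNumber_graphCopies_graphFan hk ht]
  refine le_antisymm (Nat.sInf_le ⟨fanColoring k t, (0 : Fin 3), ?_⟩) ?_
  · exact (ncard_colorClass_fanColoring k t).symm
  · refine le_csInf ⟨_, fanColoring k t, (0 : Fin 3), rfl⟩ ?_
    rintro _ ⟨C, a, rfl⟩
    exact le_ncard_colorClass hk C a

end Coloring

/-! ### The extremal colouring. -/

section LowerBound

/-- The partition of the vertices into the red cliques of the extremal colouring. -/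
def extremalClass (n : ℕ) {N : ℕ} (x : Fin N) : Fin 3 :=
  if (x : ℕ) < n then 0 else if (x : ℕ) < 2 * n then 1 else 2

/-- The red graph of the extremal colouring: two cliques of order `n` and one clique on the
remaining vertices. -/
def extremalGraph (n N : ℕ) : SimpleGraph (Fin N) where
  Adj x y := x ≠ y ∧ extremalClass n x = extremalClass n y
  symm.symm _ _ h := ⟨h.1.symm, h.2.symm⟩
  loopless.irrefl _ h := h.1 rfl

/-- Only upper bounds on the class sizes matter, so one statement serves every N below the Ramsey
number. -/
theorem card_le_of_extremalClass_eq {n N m : ℕ} (a : Fin 3) (S : Finset (Fin N))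
    (hS : ∀ x ∈ S, extremalClass n x = a) (h₂ : N ≤ 2 * n + m) :
    S.card ≤ if a = 2 then m else n := by
  have H : ∀ p q : ℕ, (∀ x ∈ S, p ≤ (x : ℕ) ∧ (x : ℕ) < q) → S.card ≤ q - p := fun p q h => by
    rw [← Nat.card_Ico]
    exact Finset.card_le_card_of_injOn (fun x => (x : ℕ))
      (fun x hx => by simpa using h x hx) Fin.val_injective.injOn
  obtain rfl | rfl | rfl : a = 0 ∨ a = 1 ∨ a = 2 := by fin_cases a <;> simp
  · have := H 0 n fun x hx => by
      have := hS x hx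
      simp only [extremalClass] at this
      split_ifs at this <;> omega
    rw [if_neg (by decide)]
    omega
  · have := H n (2 * n) fun x hx => by
      have := hS x hx
      simp only [extremalClass] at this
      split_ifs at this <;> omega
    rw [if_neg (by decide)]
    omega
  · have := H (2 * n) N fun x hx => by
      have := hS x hx
      simp only [extremalClass] at this
      split_ifs at this <;> omega
    rw [if_pos rfl]
    omega

theorem graphStar_not_isContained_extremalGraph {n N m : ℕ} (hm : m ≤ n) (hN : N ≤ 2 * n + m) :
    ¬ (graphStar n).IsContained (extremalGraph n N) := by
  rintro ⟨f⟩
  have h := card_le_of_extremalClass_eq (extremalClass n (f (Sum.inl 0)))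
    (Finset.univ.map ⟨f, f.injective⟩) (fun x hx => by
      simp only [Finset.mem_map, Finset.mem_univ, true_and, Function.Embedding.coeFn_mk] at hx
      obtain ⟨y | y, rfl⟩ := hx
      · rw [Subsingleton.elim y 0]
      · have : (graphStar n).Adj (Sum.inr y) (Sum.inl 0) := by simp [graphStar]
        exact (f.toHom.map_adj this).2) hN
  rw [Finset.card_map, Finset.card_univ, Fintype.card_sum, Fintype.card_fin, Fintype.card_fin] at h
  split_ifs at h <;> omega

theorem graphCopies_graphFan_not_isContained_compl {k t n N : ℕ} (hk : 0 < k) (ht : 0 < t)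
    (hN : N ≤ 2 * n + (t - 1)) :
    ¬ (graphCopies t (graphFan k)).IsContained (extremalGraph n N)ᶜ := by
  rintro ⟨f⟩
  let C : (graphCopies t (graphFan k)).Coloring (Fin 3) :=
    Coloring.mk (fun v => extremalClass n (f v)) fun {v w} h h' => by
      have := f.toHom.map_adj h
      rw [compl_adj] at this
      exact this.2 ⟨this.1, h'⟩
  have h1 := le_ncard_colorClass hk C 2
  rw [← Set.ncard_image_of_injective _ f.injective, Set.ncard_eq_toFinset_card _ (Set.toFinite _)]
    at h1
  have h2 := card_le_of_extremalClass_eq (n := n) 2 (Set.toFinite (f '' C.colorClass 2)).toFinset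
    (fun x hx => by
      rw [Set.Finite.mem_toFinset] at hx
      obtain ⟨v, hv, rfl⟩ := hx
      exact hv) hN
  rw [if_pos rfl] at h2
  omega

end LowerBound

/-! ### The Ramsey number and goodness. -/

theorem ramseyNumber_graphStar_graphCopies_graphFan {k t n : ℕ} (hk : 1 ≤ k) (ht : 1 ≤ t)
    (hn : 12 * t * k + 2 * k ≤ n) (hn' : 4 * t * k ^ 2 ≤ n) :
    ramseyNumber (graphStar (n - 1)) (graphCopies t (graphFan k)) = 2 * n + t - 2 := by
  have htk : t ≤ t * k := Nat.le_mul_of_pos_right _ hk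
  have htn : t < n := by rw [mul_assoc] at hn; omega
  have hmem : 2 * n + t - 2 ∈ {N : ℕ | 0 < N ∧ ∀ R : SimpleGraph (Fin N),
      (graphStar (n - 1)).IsContained R ∨ (graphCopies t (graphFan k)).IsContained Rᶜ} := by
    refine ⟨by omega, fun R => or_iff_not_imp_left.2 fun hR => ?_⟩
    refine graphCopies_graphFan_isContained_of_minDegree hk ht hn hn'
      (by rw [Fintype.card_fin]; omega) fun v => ?_
    -- Red degrees are at most n-2 among 2n+t-3 other vertices, so blue degrees are at least n+t-1.
    have h1 : (nbrsIn R Finset.univ v).card < n - 1 := by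
      by_contra! h
      exact hR (graphStar_isContained_of_le_card h)
    have h2 : Finset.univ ⊆ insert v (nbrsIn R Finset.univ v ∪ nbrsIn Rᶜ Finset.univ v) :=
      fun x _ => by
        by_cases hx : x = v
        · simp [hx]
        · by_cases hRx : R.Adj v x <;> simp [hx, hRx, Ne.symm hx]
    have h3 := (Finset.card_le_card h2).trans (Finset.card_insert_le _ _)
    have h4 := Finset.card_union_le (nbrsIn R Finset.univ v) (nbrsIn Rᶜ Finset.univ v)
    rw [Finset.card_univ, Fintype.card_fin] at h3
    omega
  refine le_antisymm (Nat.sInf_le hmem) (le_csInf ⟨_, hmem⟩ ?_)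
  rintro N ⟨-, hN⟩
  by_contra! hlt
  -- The red cliques have at most n-1, n-1 and t-1 vertices, whereas the star has n.
  have hN' : N ≤ 2 * (n - 1) + (t - 1) := by omega
  rcases hN (extremalGraph (n - 1) N) with h | h
  · exact graphStar_not_isContained_extremalGraph (by omega) hN' h
  · exact graphCopies_graphFan_not_isContained_compl hk ht hN' h

theorem theorem1p7 (k t n : ℕ) (hk : 1 ≤ k) (ht : 1 ≤ t)
    (hn : max (12 * t * k + 2 * k) (4 * t * k ^ 2) ≤ n) :
    ramseyNumber (graphStar (n - 1)) (graphCopies t (graphFan k)) = 2 * n + t - 2 ∧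
      IsRamseyGood (graphStar (n - 1)) (graphCopies t (graphFan k)) := by
  obtain ⟨hn₁, hn₂⟩ := max_le_iff.1 hn
  have htk : t ≤ t * k := Nat.le_mul_of_pos_right _ hk
  have htn : t < n := by rw [mul_assoc] at hn₁; omega
  have hr := ramseyNumber_graphStar_graphCopies_graphFan hk ht hn₁ hn₂
  have hcard : Nat.card (Fin 1 ⊕ Fin (n - 1)) = n := by
    rw [Nat.card_sum, Nat.card_fin, Nat.card_fin]; omega
  refine ⟨hr, graphStar_connected _, ?_, ?_⟩
  · rw [chromaticSurplus_graphCopies_graphFan hk ht, hcard]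
    exact htn.le
  · rw [hr, chromaticSurplus_graphCopies_graphFan hk ht, hcard,
      chromaticNumber_graphCopies_graphFan hk ht]
    change _ = (3 - 1) * _ + _
    omega
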